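/- **Setting.** Let $\mathcal X$ be an infinite measurable space in which singletons are measurable, and let $\mathcal Y=\{0,1\}$. A class $\mathcal H$ of functions $\mathcal X\to\mathcal Y$ has VC dimension $d$ if $d$ is the largest cardinality of a finite set $A\subseteq\mathcal X$ such that every map $A\to\mathcal Y$ is the restriction of some $h\in\mathcal H$. A sample $s=((x_i,y_i))_{i\le n}$ is realizable by $\mathcal H$ if some $h\in\mathcal H$ has $h(x_i)=y_i$ for all $i$; the empirical risk of $h$ on $s$ is $\hat R_s(h)=\frac1n|\{i: h(x_i)\ne y_i\}|$. A proper learner $\mathcal A=(\mathcal A_n)_{n\ge1}$ for $\mathcal H$ is a sequence of randomized maps (Markov kernels) $\mathcal A_n$ from $(\mathcal X\times\mathcal Y)^n$ to $\mathcal H$, where $\mathcal H$ carries the $\sigma$-algebra generated by the evaluations $h\mapsto h(x)$. For a probability distribution $\mathcal D$ on $\mathcal X\times\mathcal Y$, let $Z=(Z_{i,j})_{i\in\{0,1\},1\le j\le n}$ be i.i.d. with law $\mathcal D$, let $U=(U_1,\dots,U_n)$ be independent fair bits independent of $Z$, and let $S_n=(Z_{U_j,j})_{j\le n}$; then $\mathrm{CMI}_{\mathcal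 D}(\mathcal A_n)=I(\mathcal A_n(S_n);U\mid Z)$, the internal randomness of $\mathcal A_n$ being independent of $(Z,U)$. For $f:\mathbb N\to\mathbb R$ (where $0\in\mathbb N$) and $c\ge 0$ let $P(f,c)$ be the statement: for every integer $d\ge0$ and every class $\mathcal H$ of measurable functions $\mathcal X\to\mathcal Y$ of VC dimension $d$ there is a proper learner $\mathcal A$ for $\mathcal H$ such that for every $n\ge \max(d,1)$ one has $\mathrm{CMI}_{\mathcal D}(\mathcal A_n)\le f(d)$ for all distributions $\mathcal D$ on $\mathcal X\times\mathcal Y$, and $\mathbb E\,\hat R_s(\mathcal A_n(s))\le c\,\frac dn$ for every realizable $s\in(\mathcal X\times\mathcal Y)^n$, the expectation being over the randomness of $\mathcal A_n$ only. **Theorem.** There are no $f:\mathbb N\to\mathbb R$ and $c\ge0$ such that $P(f,c)$ holds. Consequently, there are no linear $f$ (that is, $f(d)=a\,d$ for some $a\in\mathbb R$) and $c\ge0$ such that $P(f,c)$ holds, and no linear $f$ such that $P(f,0)$ holds. -/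

import Mathlib

open MeasureTheory ProbabilityTheory
open scoped ENNReal

namespace CMILearning

/-- Labels are binary; a classifier on the instance space `X` is a function `X → Bool`. -/
abbrev Classifier (X : Type*) := X → Bool

/-- A labelled example. -/
abbrev Example (X : Type*) := X × Bool

/-- `H` shatters the finite set `A`: every labelling of the points of `A` is induced by a member
of `H`. -/
def Shatters {X : Type*} (H : Set (Classifier X)) (A : Finset X) : Prop :=
  ∀ g : X → Bool, ∃ h ∈ H, ∀ x ∈ A, h x = g x

/-- `H` is a VC class of dimension `d`: `d` is the largest cardinality of a shattered finite set.
The empty class shatters nothing, not even `∅`, so it has no dimension in this sense. -/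
def HasVCDim {X : Type*} (H : Set (Classifier X)) (d : ℕ) : Prop :=
  IsGreatest {k : ℕ | ∃ A : Finset X, A.card = k ∧ Shatters H A} d

/-- The empirical risk of the classifier `h` on the sample `s`. -/
noncomputable def empRisk {X : Type*} {n : ℕ} (s : Fin n → Example X) (h : Classifier X) : ℝ :=
  ((Finset.univ.filter fun i => h (s i).1 ≠ (s i).2).card : ℝ) / n

/-- The sample `s` is realizable by the class `H`. -/
def RealizableSample {X : Type*} {n : ℕ} (H : Set (Classifier X)) (s : Fin n → Example X) : Prop :=
  ∃ h ∈ H, ∀ i, h (s i).1 = (s i).2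

/-- A (randomized) proper learner for `H`: for every sample size `n`, a Markov kernel from samples
of size `n` to members of `H`.  The class `H` carries the σ-algebra generated by the evaluations
`h ↦ h x`, the smallest one for which all empirical risks are measurable. -/
structure ProperLearner {X : Type*} [MeasurableSpace X] (H : Set (Classifier X)) where
  /-- the law of the output of the learner given the sample -/
  law : ∀ n : ℕ, Kernel (Fin n → Example X) H
  isMarkov : ∀ n, IsMarkovKernel (law n)

attribute [instance] ProperLearner.isMarkov

/-- The conditional mutual information `I(V; W | Z)`, in nats, when `Z` has law `μ` and `η` is the
conditional law of `(V, W)` given `Z`: the Kullback–Leibler divergence of the law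
`P_Z P_{(V,W)|Z}` of `(Z, (V, W))` from `P_Z (P_{V|Z} × P_{W|Z})`. -/
noncomputable def condMutualInfo {α β γ : Type*} [MeasurableSpace α] [MeasurableSpace β]
    [MeasurableSpace γ] (μ : Measure α) (η : Kernel α (β × γ)) : ℝ≥0∞ :=
  InformationTheory.klDiv (μ.compProd η) (μ.compProd (η.fst.prod η.snd))

/-- The sample `((Z_{U_j, j}))_j` selected by the bits `U` from the array `Z`. -/
def select {E : Type*} {n : ℕ} (p : (Bool × Fin n → E) × (Fin n → Bool)) : Fin n → E :=
  fun j => p.1 (p.2 j, j)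

theorem measurable_select {E : Type*} [MeasurableSpace E] {n : ℕ} :
    Measurable (select : (Bool × Fin n → E) × (Fin n → Bool) → Fin n → E) := by
  refine measurable_pi_lambda _ fun j => ?_
  have h : (fun p : (Bool × Fin n → E) × (Fin n → Bool) => select p j)
      = fun p => if p.2 j = true then p.1 (true, j) else p.1 (false, j) := by
    funext p
    cases hb : p.2 j <;> simp [select, hb]
  rw [h]
  refine Measurable.ite ?_ (by fun_prop) (by fun_prop)
  have hm : Measurable fun p : (Bool × Fin n → E) × (Fin n → Bool) => p.2 j := by fun_prop
  exact hm (measurableSet_singleton true)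

/-- The law of `n` independent fair bits. -/
noncomputable def fairBits (n : ℕ) : Measure (Fin n → Bool) :=
  Measure.pi fun _ => (PMF.uniformOfFintype Bool).toMeasure

instance (n : ℕ) : IsProbabilityMeasure (fairBits n) := by
  unfold fairBits; infer_instance

/-- The conditional law of `(U, 𝒜(S))` given the array `Z`, where `U` consists of `n` fair bits
independent of `Z`, `S` is the sample selected by `U` from `Z`, and `κ` is the law of the output of
the learner `𝒜` given its sample. -/
noncomputable def bitsOutputKernel {E W : Type*} [MeasurableSpace E] [MeasurableSpace W] {n : ℕ}
    (κ : Kernel (Fin n → E) W) [IsMarkovKernel κ] : Kernel (Bool × Fin n → E) ((Fin n → Bool) × W) :=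
  (Kernel.const _ (fairBits n)).compProd (κ.comap select measurable_select)

/-- The conditional mutual information `CMI_D(𝒜) = I(𝒜(S); U | Z)` at sample size `n` of the
learner with kernel `κ`, where `Z` is an array of `2 × n` independent examples with law `D`. -/
noncomputable def cmi {E W : Type*} [MeasurableSpace E] [MeasurableSpace W] {n : ℕ}
    (D : Measure E) (κ : Kernel (Fin n → E) W) [IsMarkovKernel κ] : ℝ≥0∞ :=
  condMutualInfo (Measure.pi fun _ : Bool × Fin n => D) (bitsOutputKernel κ)

/-- Every VC class of measurable classifiers on `X`, of any dimension `d`, has a proper learner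
such that for all sample sizes `n ≥ d` (`n` positive) its CMI is at most `f d` for every
distribution, and its expected empirical risk is at most `c * d / n` on every realizable sample. -/
def LearnersWithin (X : Type*) [MeasurableSpace X] (f : ℕ → ℝ) (c : ℝ) : Prop :=
  ∀ (d : ℕ) (H : Set (Classifier X)), (∀ h ∈ H, Measurable h) → HasVCDim H d →
    ∃ A : ProperLearner H, ∀ n : ℕ, 1 ≤ n → d ≤ n →
      (∀ D : Measure (Example X), IsProbabilityMeasure D →
        (cmi D (A.law n) : EReal) ≤ (f d : EReal)) ∧
      (∀ s : Fin n → Example X, RealizableSample H s →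
        ∫ h, empRisk s h.1 ∂(A.law n s) ≤ c * (d / n))

/-- `f` is linear. -/
def IsLinearBound (f : ℕ → ℝ) : Prop := ∃ a : ℝ, ∀ d : ℕ, f d = a * d

end CMILearning

/-!
Already the case `d = 1` is impossible.  Fix `f` and `c`, put `m = 2 * 4 ^ C` and `n = C * m` for a
large constant `C`, and let `H` consist of the indicators of `m + 1` distinct points.  For each of
these points `k` let `D_k` be the uniform distribution on the other `m` points, all labelled
`false`; samples from `D_k` are realized by the indicator of `k`.

*A bounded CMI forces identification of `k`.*  By the variational inequality
`∫ g ∂P ≤ KL(P ‖ Q)` for `∫ exp g ∂Q ≤ 1` (`ofReal_integral_le_klDiv`), applied to `log (3/2)` times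
the number of errors on the unselected examples minus `log 2` times the number of errors on the
selected ones, the CMI bounds the population risk up to the training errors
(`generalization_le_cmi`).  The training errors number at most `c` in expectation, so the risk under
`D_k` is `O(1 / n)`.  Each member of `H` other than the indicator of `k` has risk `1 / m` under
`D_k`, so the learner outputs the indicator of `k` except with probability `O(m / n) = O(1 / C)`,
which is at most `1 / 8` (`integral_missProb_le`).

*Identification is impossible.*  About `m * exp (-C)` of the `m` points in the support of `D_k` are
missing from a sample of size `n`, and `D_k` and `D_l` agree on samples that avoid both `k` and `l`,
so the learner cannot tell `k` from the other missing points.  A second moment bound on the number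
of missing points turns this into an average error probability of at least `1 / 4`
(`identification_lower_bound`).
-/

open MeasureTheory ProbabilityTheory
open scoped ENNReal

namespace CMILearning

/-! ### A variational lower bound for the Kullback–Leibler divergence -/

/-- The Fenchel–Young inequality for `klFun`, whose convex conjugate is `t ↦ exp t - 1`. -/
theorem mul_le_klFun_add_exp_sub_one {r : ℝ} (hr : 0 ≤ r) (t : ℝ) :
    r * t ≤ InformationTheory.klFun r + (Real.exp t - 1) := by
  rw [InformationTheory.klFun_apply]
  rcases hr.eq_or_lt with rfl | hr
  · simpa using Real.exp_nonneg t
  · have h := mul_le_mul_of_nonneg_left (Real.add_one_le_exp (t - Real.log r)) hr.le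
    rw [Real.exp_sub, Real.exp_log hr, mul_div_cancel₀ _ hr.ne'] at h
    linarith

/-- The lower bound of Donsker and Varadhan, in the weak form obtained by integrating the
Fenchel–Young inequality. -/
theorem ofReal_integral_le_klDiv {α : Type*} [MeasurableSpace α] {P Q : Measure α}
    [IsProbabilityMeasure P] [IsProbabilityMeasure Q] {g : α → ℝ} (hg : Measurable g)
    (hgP : Integrable g P) (hexp : ∫⁻ x, ENNReal.ofReal (Real.exp (g x)) ∂Q ≤ 1) :
    ENNReal.ofReal (∫ x, g x ∂P) ≤ InformationTheory.klDiv P Q := by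
  by_cases htop : InformationTheory.klDiv P Q = ∞
  · simp [htop]
  obtain ⟨hac, hllr⟩ := InformationTheory.klDiv_ne_top_iff.1 htop
  refine ENNReal.ofReal_le_of_le_toReal ?_
  rw [InformationTheory.toReal_klDiv_eq_integral_klFun hac, ← integral_toReal_rnDeriv_mul hac]
  have hint : Integrable (fun x => Real.exp (g x)) Q :=
    (lintegral_ofReal_ne_top_iff_integrable (by fun_prop)
      (ae_of_all _ fun _ => Real.exp_nonneg _)).1 (ne_top_of_le_ne_top ENNReal.one_ne_top hexp)
  have hle : ∫ x, Real.exp (g x) ∂Q ≤ 1 := by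
    rw [integral_eq_lintegral_of_nonneg_ae (ae_of_all _ fun _ => Real.exp_nonneg _) (by fun_prop)]
    simpa using ENNReal.toReal_mono ENNReal.one_ne_top hexp
  have hkl := (InformationTheory.integrable_klFun_rnDeriv_iff hac).2 hllr
  have hsub : Integrable (fun x => Real.exp (g x) - 1) Q := hint.sub (integrable_const _)
  calc ∫ x, (P.rnDeriv Q x).toReal * g x ∂Q
      ≤ ∫ x, (InformationTheory.klFun (P.rnDeriv Q x).toReal + (Real.exp (g x) - 1)) ∂Q :=
        integral_mono ((integrable_toReal_rnDeriv_mul_iff hac).2 hgP)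
          (hkl.add hsub)
          fun x => mul_le_klFun_add_exp_sub_one ENNReal.toReal_nonneg _
    _ ≤ ∫ x, InformationTheory.klFun (P.rnDeriv Q x).toReal ∂Q := by
        rw [integral_add hkl hsub,
          integral_sub hint (integrable_const _)]
        simp only [integral_const, probReal_univ, smul_eq_mul, mul_one]
        linarith

/-- Distinct coordinates of a product of copies of `D` are again independent with law `D`. -/
theorem map_pi_comp_injective {I J E : Type*} [Fintype I] [Fintype J] [MeasurableSpace E]
    (D : Measure E) [IsProbabilityMeasure D] {σ : J → I} (hσ : σ.Injective) :
    (Measure.pi fun _ : I => D).map (fun z j => z (σ j)) = Measure.pi fun _ : J => D := by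
  classical
  refine (Measure.pi_eq fun s hs => ?_).symm
  rw [Measure.map_apply (by fun_prop) (MeasurableSet.univ_pi hs)]
  have hpre : (fun (z : I → E) j => z (σ j)) ⁻¹' Set.univ.pi s
      = Set.univ.pi (Function.extend σ s fun _ => Set.univ) := by
    ext z
    simp only [Set.mem_preimage, Set.mem_univ_pi]
    refine ⟨fun h i => ?_, fun h j => by simpa [hσ.extend_apply] using h (σ j)⟩
    by_cases hi : ∃ j, σ j = i
    · obtain ⟨j, rfl⟩ := hi
      simpa [hσ.extend_apply] using h j
    · simp [Function.extend_apply' _ _ _ hi]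
  rw [hpre, Measure.pi_pi]
  rw [← Finset.prod_subset (Finset.subset_univ (Finset.univ.image σ)),
    Finset.prod_image fun a _ b _ h => hσ h]
  · simp [hσ.extend_apply]
  · intro i _ hi
    rw [Function.extend_apply' _ _ _ (by simpa using hi), measure_univ]

theorem lintegral_pi_option {J E : Type*} [Fintype J] [MeasurableSpace E]
    (D : Measure E) [IsProbabilityMeasure D] {F : (J → E) → E → ℝ≥0∞}
    (hF : Measurable (Function.uncurry F)) :
    ∫⁻ y, F (fun j => y (some j)) (y none) ∂(Measure.pi fun _ : Option J => D)
      = ∫⁻ S, ∫⁻ e, F S e ∂D ∂(Measure.pi fun _ : J => D) := by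
  rw [← Measure.pi_map_piOptionEquivProd, lintegral_map_equiv]
  exact lintegral_prod (Function.uncurry F) hF.aemeasurable

/-- For fixed bits `u`, the selected sample and the unselected example of the pair `i` are
independent. -/
theorem lintegral_select_ghost {E : Type*} [MeasurableSpace E] {n : ℕ}
    (D : Measure E) [IsProbabilityMeasure D] {F : (Fin n → E) → E → ℝ≥0∞}
    (hF : Measurable (Function.uncurry F)) (u : Fin n → Bool) (i : Fin n) :
    ∫⁻ z, F (select (z, u)) (z (!u i, i)) ∂(Measure.pi fun _ : Bool × Fin n => D)
      = ∫⁻ S, ∫⁻ e, F S e ∂D ∂(Measure.pi fun _ : Fin n => D) := by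
  have hm : Measurable fun y : Option (Fin n) → E => F (fun j => y (some j)) (y none) :=
    hF.comp (f := fun y : Option (Fin n) → E => ((fun j => y (some j)), y none)) (by fun_prop)
  have hσ : Function.Injective
      (fun o : Option (Fin n) => o.elim (!u i, i) fun j => (u j, j)) := by
    rintro (_ | a) (_ | b) h <;> simp_all <;> grind
  rw [← lintegral_pi_option D hF, ← map_pi_comp_injective D hσ, lintegral_map hm (by fun_prop)]
  rfl

theorem map_select {E : Type*} [MeasurableSpace E] {n : ℕ}
    (D : Measure E) [IsProbabilityMeasure D] (u : Fin n → Bool) :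
    (Measure.pi fun _ : Bool × Fin n => D).map (fun z => select (z, u))
      = Measure.pi fun _ : Fin n => D :=
  map_pi_comp_injective D (σ := fun j => (u j, j)) fun _ _ h => (Prod.ext_iff.1 h).2

/-! ### CMI bounds the population risk -/

/-- Here `a i b` is the loss on the example `(b, i)`.  The constants `log (3 / 2)` and `log 2` make
the average over one bit at most `1` for each of the four possible pairs of losses: if exactly one
of the two is nonzero it is `(3 / 2 + 1 / 2) / 2 = 1`. -/
theorem lintegral_fairBits_exp_sum_le_one {n : ℕ} (a : Fin n → Bool → ℝ)
    (ha : ∀ i b, a i b = 0 ∨ a i b = 1) :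
    ∫⁻ u, ENNReal.ofReal
      (Real.exp (∑ i, (Real.log (3 / 2) * a i (!u i) - Real.log 2 * a i (u i)))) ∂fairBits n
      ≤ 1 := by
  have hbit (i : Fin n) : ∫ b, Real.exp (Real.log (3 / 2) * a i (!b) - Real.log 2 * a i b)
      ∂(PMF.uniformOfFintype Bool).toMeasure ≤ 1 := by
    rw [PMF.integral_eq_sum]
    rcases ha i true with h1 | h1 <;> rcases ha i false with h2 | h2 <;>
      simp [h1, h2, Real.exp_sub, Real.exp_log] <;> norm_num
  rw [← ofReal_integral_eq_lintegral_ofReal .of_finite (ae_of_all _ fun _ => Real.exp_nonneg _)]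
  simp_rw [Real.exp_sum]
  rw [fairBits, integral_fintype_prod_eq_prod
    (fun i b => Real.exp (Real.log (3 / 2) * a i (!b) - Real.log 2 * a i b))]
  exact ENNReal.ofReal_le_one.2 (Finset.prod_le_one
    (fun i _ => integral_nonneg fun _ => Real.exp_nonneg _) fun i _ => hbit i)

instance isMarkovKernel_bitsOutputKernel {E W : Type*} [MeasurableSpace E] [MeasurableSpace W]
    {n : ℕ} (κ : Kernel (Fin n → E) W) [IsMarkovKernel κ] :
    IsMarkovKernel (bitsOutputKernel κ) := by
  unfold bitsOutputKernel; infer_instance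

/-- Under the joint law of `(Z, (U, 𝒜(S)))`, the bits may be drawn before the array. -/
theorem compProd_bitsOutputKernel_apply {E W : Type*} [MeasurableSpace E] [MeasurableSpace W]
    {n : ℕ} (μ : Measure (Bool × Fin n → E)) [IsProbabilityMeasure μ]
    (κ : Kernel (Fin n → E) W) [IsMarkovKernel κ]
    {A : Set ((Bool × Fin n → E) × ((Fin n → Bool) × W))} (hA : MeasurableSet A) :
    (μ.compProd (bitsOutputKernel κ)) A
      = ∫⁻ u, ∫⁻ z, κ (select (z, u)) {w | (z, (u, w)) ∈ A} ∂μ ∂fairBits n := by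
  have hm : Measurable fun p : (Bool × Fin n → E) × (Fin n → Bool) =>
      κ (select p) {w | (p.1, (p.2, w)) ∈ A} :=
    Kernel.measurable_kernel_prodMk_left (κ := κ.comap select measurable_select)
      (t := {q | (q.1.1, (q.1.2, q.2)) ∈ A}) (hA.preimage (by fun_prop))
  rw [lintegral_lintegral_swap (f := fun u z => κ (select (z, u)) {w | (z, (u, w)) ∈ A})
    (hm.comp measurable_swap).aemeasurable, Measure.compProd_apply hA]
  refine lintegral_congr fun z => ?_
  rw [bitsOutputKernel, Kernel.compProd_apply (hA.preimage (by fun_prop))]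
  rfl

section
variable {E W : Type*} [MeasurableSpace E] [MeasurableSpace W] {n : ℕ}

theorem compProd_bitsOutputKernel_trainLoss (D : Measure E) [IsProbabilityMeasure D]
    (κ : Kernel (Fin n → E) W) [IsMarkovKernel κ] {L : Set (E × W)} (hL : MeasurableSet L)
    (hA : ∀ i, MeasurableSet {p : (Bool × Fin n → E) × ((Fin n → Bool) × W) |
      (select (p.1, p.2.1) i, p.2.2) ∈ L}) (i : Fin n) :
    ((Measure.pi fun _ : Bool × Fin n => D).compProd (bitsOutputKernel κ))
        {p | (select (p.1, p.2.1) i, p.2.2) ∈ L}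
      = ∫⁻ S, κ S {w | (S i, w) ∈ L} ∂(Measure.pi fun _ : Fin n => D) := by
  have hm : Measurable fun S : Fin n → E => κ S {w | (S i, w) ∈ L} :=
    Kernel.measurable_kernel_prodMk_left (κ := κ) (t := {q | (q.1 i, q.2) ∈ L})
      (hL.preimage (by fun_prop))
  rw [compProd_bitsOutputKernel_apply _ _ (hA i)]
  have h (u : Fin n → Bool) : ∫⁻ z, κ (select (z, u)) {w | (select (z, u) i, w) ∈ L}
      ∂(Measure.pi fun _ : Bool × Fin n => D)
        = ∫⁻ S, κ S {w | (S i, w) ∈ L} ∂(Measure.pi fun _ : Fin n => D) := by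
    have hsel : Measurable fun z : Bool × Fin n → E => select (z, u) :=
      measurable_select.comp (f := fun z => (z, u)) (by fun_prop)
    rw [← map_select D u, lintegral_map hm hsel]
  simp [h]

theorem compProd_bitsOutputKernel_ghostLoss (D : Measure E) [IsProbabilityMeasure D]
    (κ : Kernel (Fin n → E) W) [IsMarkovKernel κ] {L : Set (E × W)} (hL : MeasurableSet L)
    (hA : ∀ i, MeasurableSet {p : (Bool × Fin n → E) × ((Fin n → Bool) × W) |
      (p.1 (!p.2.1 i, i), p.2.2) ∈ L}) (i : Fin n) :
    ((Measure.pi fun _ : Bool × Fin n => D).compProd (bitsOutputKernel κ))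
        {p | (p.1 (!p.2.1 i, i), p.2.2) ∈ L}
      = ∫⁻ S, ∫⁻ e, κ S {w | (e, w) ∈ L} ∂D ∂(Measure.pi fun _ : Fin n => D) := by
  rw [compProd_bitsOutputKernel_apply _ _ (hA i)]
  have hm : Measurable (Function.uncurry fun (S : Fin n → E) e => κ S {w | (e, w) ∈ L}) :=
    Kernel.measurable_kernel_prodMk_left
      (κ := κ.comap (Prod.fst : (Fin n → E) × E → _) (by fun_prop))
      (t := {q | (q.1.2, q.2) ∈ L}) (hL.preimage (by fun_prop))
  have h := fun u => lintegral_select_ghost D hm u i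
  simp [h]

/-- For a loss set `L`, the CMI bounds `log (3 / 2)` times the expected number of losses on a fresh
sample of size `n` minus `log 2` times the expected number of losses on the training sample. -/
theorem generalization_le_cmi (D : Measure E) [IsProbabilityMeasure D]
    (κ : Kernel (Fin n → E) W) [IsMarkovKernel κ] {L : Set (E × W)} (hL : MeasurableSet L) :
    ENNReal.ofReal
      (Real.log (3 / 2) * n *
          (∫⁻ S, ∫⁻ e, κ S {w | (e, w) ∈ L} ∂D ∂(Measure.pi fun _ : Fin n => D)).toReal
        - Real.log 2 * ∑ i, (∫⁻ S, κ S {w | (S i, w) ∈ L} ∂(Measure.pi fun _ : Fin n => D)).toReal)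
      ≤ cmi D κ := by
  set μ := Measure.pi fun _ : Bool × Fin n => D with hμ
  let train (i : Fin n) : Set ((Bool × Fin n → E) × ((Fin n → Bool) × W)) :=
    {p | (select (p.1, p.2.1) i, p.2.2) ∈ L}
  let ghost (i : Fin n) : Set ((Bool × Fin n → E) × ((Fin n → Bool) × W)) :=
    {p | (p.1 (!p.2.1 i, i), p.2.2) ∈ L}
  have hnot : Measurable fun u : Fin n → Bool => fun j => !u j := measurable_of_finite _
  have htrain (i) : MeasurableSet (train i) := by
    refine hL.preimage (Measurable.prodMk ?_ (by fun_prop))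
    exact (measurable_pi_apply i).comp (measurable_select.comp (by fun_prop))
  have hghost (i) : MeasurableSet (ghost i) := by
    refine hL.preimage (Measurable.prodMk ?_ (by fun_prop))
    exact (measurable_pi_apply i).comp (measurable_select.comp
      (f := fun p : (Bool × Fin n → E) × ((Fin n → Bool) × W) => (p.1, fun j => !p.2.1 j))
      (measurable_fst.prodMk (hnot.comp (by fun_prop))))
  let g (p : (Bool × Fin n → E) × ((Fin n → Bool) × W)) : ℝ :=
    ∑ i, (Real.log (3 / 2) * (ghost i).indicator 1 p - Real.log 2 * (train i).indicator 1 p)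
  have hg : Measurable g := by
    refine Finset.measurable_sum _ fun i _ => ?_
    exact ((measurable_one.indicator (hghost i)).const_mul _).sub
      ((measurable_one.indicator (htrain i)).const_mul _)
  have hind {A : Set ((Bool × Fin n → E) × ((Fin n → Bool) × W))} (hA : MeasurableSet A) :
      Integrable (A.indicator 1 : (Bool × Fin n → E) × ((Fin n → Bool) × W) → ℝ)
        (μ.compProd (bitsOutputKernel κ)) :=
    (integrable_const (1 : ℝ)).indicator hA
  have hint (i) := ((hind (hghost i)).const_mul (Real.log (3 / 2))).sub
    ((hind (htrain i)).const_mul (Real.log 2))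
  have key := ofReal_integral_le_klDiv (P := μ.compProd (bitsOutputKernel κ))
    (Q := μ.compProd ((bitsOutputKernel κ).fst.prod (bitsOutputKernel κ).snd)) hg
    (integrable_finsetSum _ fun i _ => hint i) ?_
  · refine le_trans (ENNReal.ofReal_le_ofReal (le_of_eq ?_)) key
    simp only [g]
    refine Eq.trans ?_ (integral_finsetSum _ fun i _ => hint i).symm
    simp_rw [Pi.sub_apply, integral_sub ((hind (hghost _)).const_mul _)
      ((hind (htrain _)).const_mul _), integral_const_mul,
      integral_indicator_one (hghost _), integral_indicator_one (htrain _), Measure.real,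
      train, ghost, hμ, compProd_bitsOutputKernel_trainLoss D κ hL htrain,
      compProd_bitsOutputKernel_ghostLoss D κ hL hghost, Finset.sum_sub_distrib, ← Finset.mul_sum]
    simp
    ring
  · have hG : Measurable fun p => ENNReal.ofReal (Real.exp (g p)) := by fun_prop
    rw [Measure.lintegral_compProd hG]
    refine (lintegral_mono (g := fun _ => 1) fun z => ?_).trans (by simp)
    have hfst : (bitsOutputKernel κ).fst z = fairBits n := by
      rw [bitsOutputKernel, Kernel.fst_compProd, Kernel.const_apply]
    have hGz : Measurable fun q => ENNReal.ofReal (Real.exp (g (z, q))) :=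
      hG.comp measurable_prodMk_left
    rw [Kernel.prod_apply, hfst, lintegral_prod_symm _ hGz.aemeasurable]
    refine (lintegral_mono (g := fun _ => 1) fun w => ?_).trans (by simp)
    exact lintegral_fairBits_exp_sum_le_one
      (fun i b => {b | (z (b, i), w) ∈ L}.indicator 1 b)
      fun i b => by by_cases h : (z (b, i), w) ∈ L <;> simp [h]
end

/-! ### Samples that miss points of the support -/

/-- The uniform distribution on the points `e j` with `j ≠ k`. -/
noncomputable def uniformExcept {E : Type*} [MeasurableSpace E] {m : ℕ} (e : Fin (m + 1) → E)
    (k : Fin (m + 1)) : Measure E :=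
  (m : ℝ≥0∞)⁻¹ • ∑ j ∈ Finset.univ.erase k, Measure.dirac (e j)

section
variable {E : Type*} {m : ℕ} {e : Fin (m + 1) → E}

/-- The samples in which none of the points `e j` with `j ∈ T` occurs. -/
def missing (e : Fin (m + 1) → E) (n : ℕ) (T : Finset (Fin (m + 1))) : Set (Fin n → E) :=
  Set.univ.pi fun _ => (e '' T)ᶜ

/-- The number of points other than `e l` that do not occur in the sample `S`, as a real number. -/
noncomputable def numMissing (e : Fin (m + 1) → E) (n : ℕ) (l : Fin (m + 1)) (S : Fin n → E) : ℝ :=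
  ∑ k ∈ Finset.univ.erase l, (missing e n {k}).indicator 1 S

theorem numMissing_eq_zero_or_one_le (n : ℕ) (l : Fin (m + 1)) (S : Fin n → E) :
    numMissing e n l S = 0 ∨ 1 ≤ numMissing e n l S := by
  classical
  have h : numMissing e n l S
      = (((Finset.univ.erase l).filter fun k => S ∈ missing e n {k}).card : ℝ) := by
    simp [numMissing, Set.indicator_apply]
  rw [h]
  rcases Nat.eq_zero_or_pos ((Finset.univ.erase l).filter fun k => S ∈ missing e n {k}).card
    with h | h
  · exact .inl (by exact_mod_cast h)
  · exact .inr (by exact_mod_cast h)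

theorem numMissing_nonneg (n : ℕ) (l : Fin (m + 1)) (S : Fin n → E) : 0 ≤ numMissing e n l S :=
  Finset.sum_nonneg fun _ _ => Set.indicator_nonneg (fun _ _ => zero_le_one) _

theorem numMissing_le (n : ℕ) (l : Fin (m + 1)) (S : Fin n → E) : numMissing e n l S ≤ m := by
  refine (Finset.sum_le_sum (g := fun _ => (1 : ℝ)) fun k _ =>
    Set.indicator_le_self' (fun _ _ => zero_le_one) S).trans ?_
  simp

end

section
variable {E : Type*} [MeasurableSpace E] [MeasurableSingletonClass E] {m : ℕ} {e : Fin (m + 1) → E}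

theorem uniformExcept_apply (k : Fin (m + 1)) (s : Set E) :
    uniformExcept e k s = (m : ℝ≥0∞)⁻¹ * ∑ j ∈ Finset.univ.erase k, s.indicator 1 (e j) := by
  simp [uniformExcept]

theorem isProbabilityMeasure_uniformExcept (hm : m ≠ 0) (k : Fin (m + 1)) :
    IsProbabilityMeasure (uniformExcept e k) := by
  refine ⟨?_⟩
  rw [uniformExcept_apply]
  simpa using ENNReal.inv_mul_cancel (by simpa using hm) (by simp)

/-- Away from the points `e k` and `e l`, the distributions that omit the one or the other agree. -/
theorem restrict_uniformExcept (he : e.Injective) (k l : Fin (m + 1)) :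
    (uniformExcept e k).restrict {e l}ᶜ = (uniformExcept e l).restrict {e k}ᶜ := by
  ext s hs
  rw [Measure.restrict_apply hs, Measure.restrict_apply hs, uniformExcept_apply,
    uniformExcept_apply]
  congr 1
  have h (a b : Fin (m + 1)) :
      ∑ j ∈ Finset.univ.erase a, (s ∩ {e b}ᶜ).indicator (1 : E → ℝ≥0∞) (e j)
      = ∑ j ∈ (Finset.univ.erase a).erase b, s.indicator (1 : E → ℝ≥0∞) (e j) := by
    rw [← Finset.sum_subset (Finset.erase_subset b _)]
    · refine Finset.sum_congr rfl fun j hj => ?_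
      have : e j ≠ e b := he.ne (Finset.ne_of_mem_erase hj)
      by_cases hs : e j ∈ s <;> simp [hs, this]
    · intro j hj hjb
      have : j = b := by
        by_contra h
        exact hjb (Finset.mem_erase.2 ⟨h, hj⟩)
      rw [this]
      exact Set.indicator_of_notMem (by simp) _
  rw [h, h, Finset.erase_right_comm]

theorem real_uniformExcept_compl_image (hm : m ≠ 0) (he : e.Injective) {k : Fin (m + 1)}
    {T : Finset (Fin (m + 1))} (hT : k ∉ T) :
    (uniformExcept e k).real (e '' T)ᶜ = 1 - T.card / m := by
  have := isProbabilityMeasure_uniformExcept (e := e) hm k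
  rw [probReal_compl_eq_one_sub (T.finite_toSet.image e).measurableSet]
  have hsum : ∑ j ∈ Finset.univ.erase k, (e '' T).indicator (1 : E → ℝ≥0∞) (e j) = T.card := by
    rw [← Finset.sum_subset (s₁ := T)]
    · rw [Finset.card_eq_sum_ones]
      push_cast
      refine Finset.sum_congr rfl fun j hj => ?_
      simp [he.eq_iff, hj]
    · intro j hj
      simp only [Finset.mem_erase, Finset.mem_univ, and_true]
      rintro rfl
      exact hT hj
    · intro j _ hj
      simp [he.eq_iff, hj]
  rw [Measure.real, uniformExcept_apply, hsum]
  simp [ENNReal.toReal_mul]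
  ring

theorem measurableSet_missing (n : ℕ) (T : Finset (Fin (m + 1))) :
    MeasurableSet (missing e n T) :=
  MeasurableSet.univ_pi fun _ => (T.finite_toSet.image e).measurableSet.compl

theorem real_pi_uniformExcept_missing (hm : m ≠ 0) (he : e.Injective) (n : ℕ) {k : Fin (m + 1)}
    {T : Finset (Fin (m + 1))} (hT : k ∉ T) :
    (Measure.pi fun _ : Fin n => uniformExcept e k).real (missing e n T)
      = (1 - T.card / m) ^ n := by
  have := isProbabilityMeasure_uniformExcept (e := e) hm k
  rw [missing, Measure.real, Measure.pi_pi, ENNReal.toReal_prod]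
  simp [← Measure.real_def, real_uniformExcept_compl_image hm he hT]

theorem integrable_indicator_missing (n : ℕ) (T : Finset (Fin (m + 1))) (μ : Measure (Fin n → E))
    [IsProbabilityMeasure μ] : Integrable ((missing e n T).indicator (1 : (Fin n → E) → ℝ)) μ :=
  (integrable_const (1 : ℝ)).indicator (measurableSet_missing n T)

theorem restrict_pi_uniformExcept (hm : m ≠ 0) (he : e.Injective) (n : ℕ) (k l : Fin (m + 1)) :
    (Measure.pi fun _ : Fin n => uniformExcept e k).restrict (missing e n {l})
      = (Measure.pi fun _ : Fin n => uniformExcept e l).restrict (missing e n {k}) := by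
  have := isProbabilityMeasure_uniformExcept (e := e) hm
  simp only [missing, Measure.restrict_pi_pi, Finset.coe_singleton, Set.image_singleton,
    restrict_uniformExcept he k l]

theorem measurable_numMissing (n : ℕ) (l : Fin (m + 1)) : Measurable (numMissing e n l) :=
  Finset.measurable_sum _ fun k _ => measurable_one.indicator (measurableSet_missing n {k})

theorem integral_numMissing (hm : m ≠ 0) (he : e.Injective) (n : ℕ) (l : Fin (m + 1)) :
    ∫ S, numMissing e n l S ∂(Measure.pi fun _ : Fin n => uniformExcept e l)
      = m * (1 - 1 / m) ^ n := by
  have := isProbabilityMeasure_uniformExcept (e := e) hm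
  unfold numMissing
  rw [integral_finsetSum _ fun k _ => integrable_indicator_missing n {k} _]
  rw [Finset.sum_congr rfl fun k hk => (integral_indicator_one (measurableSet_missing n {k})).trans
    (real_pi_uniformExcept_missing hm he n (by simpa using (Finset.ne_of_mem_erase hk).symm))]
  simp

theorem integral_numMissing_sq_le (hm : 2 ≤ m) (he : e.Injective) (n : ℕ) (l : Fin (m + 1)) :
    ∫ S, numMissing e n l S ^ 2 ∂(Measure.pi fun _ : Fin n => uniformExcept e l)
      ≤ m * (1 - 1 / m) ^ n + (m * (1 - 1 / m) ^ n) ^ 2 := by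
  have hm0 : m ≠ 0 := by omega
  have := isProbabilityMeasure_uniformExcept (e := e) hm0
  have hmR : (2 : ℝ) ≤ m := by exact_mod_cast hm
  set q : ℝ := (1 - 1 / m) ^ n with hq
  have hq0 : 0 ≤ q := pow_nonneg (by
    rw [sub_nonneg, div_le_one (by positivity)]; linarith) n
  have hind (k k' : Fin (m + 1)) (S : Fin n → E) :
      (missing e n {k}).indicator (1 : (Fin n → E) → ℝ) S
          * (missing e n {k'}).indicator (1 : (Fin n → E) → ℝ) S
        = (missing e n {k, k'}).indicator 1 S := by
    have : missing e n {k, k'} = missing e n {k} ∩ missing e n {k'} := by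
      ext S
      simp [missing, ← forall_and, eq_comm]
    rw [this, Set.inter_indicator_one, Pi.mul_apply]
  simp_rw [numMissing, sq, Finset.sum_mul_sum, hind]
  have hint (k k' : Fin (m + 1)) :
      Integrable ((missing e n {k, k'}).indicator (1 : (Fin n → E) → ℝ))
      (Measure.pi fun _ : Fin n => uniformExcept e l) :=
    integrable_indicator_missing n _ _
  rw [integral_finsetSum _ fun k _ => integrable_finsetSum _ fun k' _ => hint k k']
  simp_rw [integral_finsetSum _ fun k' _ => hint _ k',
    integral_indicator_one (measurableSet_missing n _)]
  calc _ ≤ ∑ k ∈ Finset.univ.erase l, ∑ k' ∈ Finset.univ.erase l,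
        ((if k = k' then q else 0) + q * q) := by
        refine Finset.sum_le_sum fun k hk => Finset.sum_le_sum fun k' hk' => ?_
        rw [real_pi_uniformExcept_missing hm0 he n (by
          simp only [Finset.mem_insert, Finset.mem_singleton]
          rintro (h | h) <;> simp_all)]
        split_ifs with h
        · subst h
          simp only [Finset.pair_eq_singleton, Finset.card_singleton, Nat.cast_one]
          rw [← hq]
          nlinarith
        · rw [Finset.card_pair h, hq, ← mul_pow, zero_add]
          refine pow_le_pow_left₀ ?_ ?_ n
          · rw [sub_nonneg, Nat.cast_ofNat, div_le_one (by positivity)]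
            exact hmR
          · have : (0 : ℝ) ≤ (1 / m) ^ 2 := by positivity
            push_cast
            ring_nf at this ⊢
            linarith
    _ = m * q + m * q * (m * q) := by
        simp_rw [Finset.sum_add_distrib]
        rw [Finset.sum_congr rfl fun k hk => Finset.sum_ite_eq_of_mem _ k (fun _ => q) hk]
        simp
        ring

/-- If `a j S` is the probability with which a randomized rule guesses `j` from the sample `S`, then
its error probability in guessing the omitted point is at least `1 / 4` on average over that point,
provided that the expected number of missing points is at least `2`. -/
theorem identification_lower_bound (hm : 2 ≤ m) (he : e.Injective) (n : ℕ)
    {a : Fin (m + 1) → (Fin n → E) → ℝ} (ha : ∀ j, Measurable (a j)) (ha0 : ∀ j S, 0 ≤ a j S)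
    (ha1 : ∀ S, ∑ j, a j S = 1) (hA : 2 ≤ (m : ℝ) * (1 - 1 / m) ^ n) :
    ((m : ℝ) + 1) / 4 ≤ ∑ k, ∫ S, (1 - a k S) ∂(Measure.pi fun _ : Fin n => uniformExcept e k) := by
  classical
  have hm0 : m ≠ 0 := by omega
  have := isProbabilityMeasure_uniformExcept (e := e) hm0
  set A : ℝ := m * (1 - 1 / m) ^ n with hAdef
  set μ : Fin (m + 1) → Measure (Fin n → E) :=
    fun k => Measure.pi fun _ : Fin n => uniformExcept e k with hμ
  have hprob (k) : IsProbabilityMeasure (μ k) := by simp only [hμ]; infer_instance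
  have hale (j S) : a j S ≤ 1 := by
    rw [← ha1 S]
    exact Finset.single_le_sum (fun i _ => ha0 i S) (Finset.mem_univ j)
  have hint (j k) : Integrable (a j) (μ k) :=
    Integrable.of_bound (ha j).aestronglyMeasurable 1 (ae_of_all _ fun S => by
      rw [Real.norm_of_nonneg (ha0 j S)]; exact hale j S)
  have hNint (l) : Integrable (numMissing e n l) (μ l) :=
    Integrable.of_bound (measurable_numMissing n l).aestronglyMeasurable m (ae_of_all _ fun S => by
      rw [Real.norm_of_nonneg (numMissing_nonneg n l S)]; exact numMissing_le n l S)
  have hN2int (l) : Integrable (fun S => numMissing e n l S ^ 2) (μ l) :=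
    Integrable.of_bound ((measurable_numMissing n l).pow_const 2).aestronglyMeasurable (m ^ 2)
      (ae_of_all _ fun S => by
        rw [Real.norm_of_nonneg (sq_nonneg _)]
        exact pow_le_pow_left₀ (numMissing_nonneg n l S) (numMissing_le n l S) 2)
  -- The rule errs at `k` if it guesses some `l ≠ k` that is missing from the sample, and on such
  -- samples the law with `k` omitted may be exchanged for the law with `l` omitted.
  have hexch (k : Fin (m + 1)) : ∑ l ∈ Finset.univ.erase k, ∫ S in missing e n {k}, a l S ∂μ l
      ≤ ∫ S, (1 - a k S) ∂μ k := by
    have h1 (S) : 1 - a k S = ∑ l ∈ Finset.univ.erase k, a l S := by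
      rw [← ha1 S, ← Finset.add_sum_erase _ _ (Finset.mem_univ k)]; ring
    simp_rw [h1]
    rw [integral_finsetSum _ fun l _ => hint l k]
    refine Finset.sum_le_sum fun l _ => ?_
    rw [← restrict_pi_uniformExcept hm0 he n k l]
    exact setIntegral_le_integral (hint l k) (ae_of_all _ fun S => ha0 l S)
  have hmul (l : Fin (m + 1)) : ∑ k ∈ Finset.univ.erase l, ∫ S in missing e n {k}, a l S ∂μ l
      = ∫ S, a l S * numMissing e n l S ∂μ l := by
    simp_rw [numMissing, Finset.mul_sum]
    rw [integral_finsetSum]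
    · refine Finset.sum_congr rfl fun k _ => ?_
      rw [← integral_indicator (measurableSet_missing n {k})]
      refine integral_congr_ae (ae_of_all _ fun S => ?_)
      by_cases h : S ∈ missing e n {k} <;> simp [h]
    · intro k _
      refine ((hint l l).indicator (measurableSet_missing (e := e) n {k})).congr
        (ae_of_all _ fun S => ?_)
      by_cases h : S ∈ missing e n {k} <;> simp [h]
  have hlow (l : Fin (m + 1)) : 1 / 2 - ∫ S, (1 - a l S) ∂μ l
      ≤ ∫ S, a l S * numMissing e n l S ∂μ l := by
    have hi1 : Integrable (fun S => 1 - a l S) (μ l) := (integrable_const _).sub (hint l l)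
    have hi2 : Integrable (fun S => a l S * numMissing e n l S) (μ l) :=
      (hint l l).mul_bdd (c := m) (measurable_numMissing n l).aestronglyMeasurable
        (ae_of_all _ fun S => by
          rw [Real.norm_of_nonneg (numMissing_nonneg n l S)]; exact numMissing_le n l S)
    -- `2 x - x ^ 2 ≤ 1` at `x = N / A`, where `N` is the number of missing points and `A` its mean,
    -- makes the left side a lower bound for the indicator of `1 ≤ N` minus `1 - a l S`.
    have hpt (S) : 2 / A * numMissing e n l S - (A ^ 2)⁻¹ * numMissing e n l S ^ 2 - (1 - a l S)
        ≤ a l S * numMissing e n l S := by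
      rcases numMissing_eq_zero_or_one_le (e := e) n l S with h | h
      · rw [h]; linarith [hale l S]
      · have h1 := mul_le_mul_of_nonneg_left h (ha0 l S)
        have h2 := sq_nonneg (1 - numMissing e n l S / A)
        have h3 : (1 - numMissing e n l S / A) ^ 2 = 1 - (2 / A * numMissing e n l S
          - (A ^ 2)⁻¹ * numMissing e n l S ^ 2) := by field_simp; ring
        linarith
    have hi3 : Integrable (fun S => 2 / A * numMissing e n l S
        - (A ^ 2)⁻¹ * numMissing e n l S ^ 2) (μ l) :=
      ((hNint l).const_mul _).sub ((hN2int l).const_mul _)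
    refine le_trans ?_ (integral_mono (hi3.sub hi1) hi2 hpt)
    simp only [Pi.sub_apply]
    rw [integral_sub hi3 hi1,
      integral_sub ((hNint l).const_mul (2 / A)) ((hN2int l).const_mul (A ^ 2)⁻¹),
      integral_const_mul, integral_const_mul, integral_numMissing hm0 he]
    have hsq := mul_le_mul_of_nonneg_left (integral_numMissing_sq_le hm he n l)
      (inv_nonneg.2 (sq_nonneg A))
    rw [← hAdef] at hsq ⊢
    have h1 : 2 / A * A = 2 := by field_simp
    have h2 : (A ^ 2)⁻¹ * (A + A ^ 2) = 1 / A + 1 := by field_simp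
    have h3 : 1 / A ≤ 1 / 2 := one_div_le_one_div_of_le two_pos hA
    rw [h1]
    rw [h2] at hsq
    linarith
  have hsum := (Finset.sum_le_sum fun l (_ : l ∈ Finset.univ) => (hlow l).trans_eq (hmul l).symm)
  rw [Finset.sum_comm' (t' := Finset.univ) (s' := fun k => Finset.univ.erase k) (by
    intro x y; simp [eq_comm])] at hsum
  have hfin := hsum.trans (Finset.sum_le_sum fun k _ => hexch k)
  rw [Finset.sum_sub_distrib] at hfin
  simp at hfin ⊢
  linarith

/-- With `m = 2 * r`, a sample of `C * m` uniform draws from `m` points avoids a given one of them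
with probability at least `(1 / 4) ^ C`, by Bernoulli's inequality with exponent `r`. -/
theorem one_quarter_pow_le (C r : ℕ) (hr : r ≠ 0) :
    (1 / 4 : ℝ) ^ C ≤ (1 - 1 / ((2 * r : ℕ) : ℝ)) ^ (C * (2 * r)) := by
  have hr' : (1 : ℝ) ≤ r := by exact_mod_cast Nat.one_le_iff_ne_zero.2 hr
  have h2 : (1 / 2 : ℝ) ≤ (1 - 1 / ((2 * r : ℕ) : ℝ)) ^ r := by
    have h := one_add_mul_le_pow (a := -(1 / ((2 * r : ℕ) : ℝ))) (by
      have : 1 / ((2 * r : ℕ) : ℝ) ≤ 1 := by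
        rw [div_le_one (by positivity)]; push_cast; linarith
      linarith) r
    have h1 : (r : ℝ) * -(1 / ((2 * r : ℕ) : ℝ)) = - (1 / 2) := by push_cast; field_simp
    rw [h1] at h
    rw [sub_eq_add_neg]
    linarith
  calc (1 / 4 : ℝ) ^ C = ((1 / 2) ^ 2) ^ C := by norm_num
    _ ≤ (((1 - 1 / ((2 * r : ℕ) : ℝ)) ^ r) ^ 2) ^ C := by gcongr
    _ = _ := by rw [← pow_mul, ← pow_mul]; congr 1; ring
end

/-! ### The class of indicators of finitely many points -/

/-- The class of the indicators of the points `ι j`. -/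
def pointClass {X J : Type*} (ι : J → X) : Set (Classifier X) :=
  {h | ∃ j, ∀ x, h x = true ↔ x = ι j}

section
variable {X J : Type*} {ι : J → X}

theorem exists_mem_pointClass (ι : J → X) (j : J) :
    ∃ h ∈ pointClass ι, ∀ x, h x = true ↔ x = ι j := by
  classical
  exact ⟨fun x => decide (x = ι j), ⟨j, by simp⟩, by simp⟩

theorem hasVCDim_pointClass (hι : ι.Injective) [Nontrivial J] : HasVCDim (pointClass ι) 1 := by
  classical
  obtain ⟨j, j', hne⟩ := exists_pair_ne J
  refine ⟨⟨{ι j}, Finset.card_singleton _, fun g => ?_⟩, ?_⟩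
  · obtain ⟨h, hh, hj⟩ := exists_mem_pointClass ι (if g (ι j) = true then j else j')
    refine ⟨h, hh, fun x hx => ?_⟩
    rw [Finset.mem_singleton.1 hx, Bool.eq_iff_iff, hj]
    split_ifs with hg <;> simp [hg, hι.eq_iff, hne]
  · rintro k ⟨A, rfl, hA⟩
    obtain ⟨h, ⟨i, hi⟩, hA⟩ := hA fun _ => true
    exact Finset.card_le_one.2 fun x hx y hy =>
      ((hi x).1 (hA x hx)).trans ((hi y).1 (hA y hy)).symm

theorem measurable_of_mem_pointClass [MeasurableSpace X] [MeasurableSingletonClass X]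
    {h : Classifier X} (hh : h ∈ pointClass ι) : Measurable h := by
  obtain ⟨j, hj⟩ := hh
  refine measurable_to_bool ?_
  convert! measurableSet_singleton (ι j)
  ext x
  simpa using hj x

/-- The pairs of an example `(ι j, false)` and a classifier that errs on it.  Restricting to these
examples makes the set jointly measurable, being a union of measurable rectangles. -/
def pointLoss (ι : J → X) : Set (Example X × pointClass ι) :=
  {p | ∃ j, p.1 = (ι j, false) ∧ p.2.1 (ι j) = true}

theorem setOf_mem_pointLoss (j : J) :
    {h : pointClass ι | ((ι j, false), h) ∈ pointLoss ι} = {h | h.1 (ι j) = true} := by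
  ext h
  simp only [pointLoss, Set.mem_ofPred_eq, Prod.mk.injEq, and_true]
  refine ⟨?_, fun hj => ⟨j, rfl, hj⟩⟩
  rintro ⟨j', hjj, hj⟩
  rwa [hjj]

theorem measurableSet_eval_eq (H : Set (Classifier X)) (x : X) (b : Bool) :
    MeasurableSet {h : H | h.1 x = b} :=
  measurableSet_eq_fun ((measurable_pi_apply x).comp measurable_subtype_coe) measurable_const

theorem integral_empRisk {H : Set (Classifier X)} (ν : Measure H) [IsProbabilityMeasure ν] {n : ℕ}
    (s : Fin n → Example X) :
    ∫ h, empRisk s h.1 ∂ν = (∑ i, ν.real {h : H | h.1 (s i).1 ≠ (s i).2}) / n := by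
  classical
  have hmeas (i) : MeasurableSet {h : H | h.1 (s i).1 ≠ (s i).2} :=
    (measurableSet_eval_eq H (s i).1 (s i).2).compl
  have h (h : H) : empRisk s h.1
      = (∑ i, {h : H | h.1 (s i).1 ≠ (s i).2}.indicator (1 : H → ℝ) h) / n := by
    rw [empRisk, Finset.card_filter]
    push_cast
    simp only [Set.indicator_apply, Set.mem_ofPred_eq, Pi.one_apply]
  have hint (i) : Integrable ({h : H | h.1 (s i).1 ≠ (s i).2}.indicator (1 : H → ℝ)) ν :=
    (integrable_const (1 : ℝ)).indicator (hmeas i)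
  simp_rw [h, integral_div]
  rw [integral_finsetSum _ fun i _ => hint i]
  simp_rw [fun i => integral_indicator_one (μ := ν) (hmeas i)]

theorem sum_measureReal_pointClass [Fintype J] (hι : ι.Injective) (ν : Measure (pointClass ι))
    [IsProbabilityMeasure ν] : ∑ j, ν.real {h : pointClass ι | h.1 (ι j) = true} = 1 := by
  have hdisj : Pairwise (Function.onFun Disjoint
      fun j => {h : pointClass ι | h.1 (ι j) = true}) := by
    intro j j' hne
    refine Set.disjoint_left.2 fun h hj hj' => hne (hι ?_)
    obtain ⟨i, hi⟩ := h.2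
    exact ((hi _).1 hj).trans ((hi _).1 hj').symm
  have hunion : ⋃ j, {h : pointClass ι | h.1 (ι j) = true} = Set.univ := by
    refine Set.eq_univ_of_forall fun h => ?_
    obtain ⟨i, hi⟩ := h.2
    exact Set.mem_iUnion.2 ⟨i, (hi _).2 rfl⟩
  have hsum := measure_iUnion (μ := ν) hdisj fun j => measurableSet_eval_eq _ (ι j) true
  rw [hunion, measure_univ, tsum_fintype] at hsum
  simp_rw [Measure.real]
  rw [← ENNReal.toReal_sum fun j _ => measure_ne_top _ _, ← hsum, ENNReal.toReal_one]

theorem measurableSet_pointLoss [MeasurableSpace X] [MeasurableSingletonClass X] [Countable J]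
    (ι : J → X) : MeasurableSet (pointLoss ι) := by
  have : pointLoss ι = ⋃ j, {(ι j, false)} ×ˢ {h : pointClass ι | h.1 (ι j) = true} := by
    ext p
    simp [pointLoss]
  rw [this]
  exact .iUnion fun j => (measurableSet_singleton _).prod (measurableSet_eval_eq _ _ _)
end

section
variable {X : Type*} [MeasurableSpace X] [MeasurableSingletonClass X] {m n : ℕ}
  {ι : Fin (m + 1) → X}

theorem ae_uniformExcept {E : Type*} [MeasurableSpace E] [MeasurableSingletonClass E]
    (e : Fin (m + 1) → E) (k : Fin (m + 1)) : ∀ᵐ x ∂uniformExcept e k, ∃ j, j ≠ k ∧ x = e j := by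
  rw [ae_iff, uniformExcept_apply]
  refine mul_eq_zero_of_right _ (Finset.sum_eq_zero fun j hj => Set.indicator_of_notMem ?_ _)
  simpa using ⟨j, Finset.ne_of_mem_erase hj, rfl⟩

theorem lintegral_pointLoss_uniformExcept (hm : m ≠ 0) (hι : ι.Injective)
    (ν : Measure (pointClass ι)) [IsProbabilityMeasure ν] (k : Fin (m + 1)) :
    ∫⁻ x, ν {h | (x, h) ∈ pointLoss ι} ∂uniformExcept (fun j => (ι j, false)) k
      = ENNReal.ofReal ((m : ℝ)⁻¹ * (1 - ν.real {h | h.1 (ι k) = true})) := by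
  have hsum : 1 - ν.real {h : pointClass ι | h.1 (ι k) = true}
      = ∑ j ∈ Finset.univ.erase k, ν.real {h : pointClass ι | h.1 (ι j) = true} := by
    rw [← sum_measureReal_pointClass hι ν, ← Finset.add_sum_erase _ _ (Finset.mem_univ k)]
    ring
  have hreal (s : Set (pointClass ι)) : ENNReal.ofReal (ν.real s) = ν s := ofReal_measureReal
  rw [uniformExcept, lintegral_smul_measure, lintegral_finsetSum_measure, hsum,
    ENNReal.ofReal_mul (by positivity), ENNReal.ofReal_sum_of_nonneg fun _ _ => measureReal_nonneg,
    ENNReal.ofReal_inv_of_pos (by positivity), ENNReal.ofReal_natCast]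
  simp_rw [lintegral_dirac, setOf_mem_pointLoss, hreal]
  rfl

/-- Samples from the distribution that omits `ι k` are almost surely realized by the indicator of
`ι k`, so that the bound on the empirical risk applies to them. -/
theorem sum_lintegral_trainLoss_le (hn : n ≠ 0) (hι : ι.Injective) (hm : m ≠ 0)
    (κ : Kernel (Fin n → Example X) (pointClass ι)) [IsMarkovKernel κ] {c : ℝ} (hc : 0 ≤ c)
    (hrisk : ∀ s : Fin n → Example X, RealizableSample (pointClass ι) s →
      ∫ h, empRisk s h.1 ∂κ s ≤ c * (((1 : ℕ) : ℝ) / n)) (k : Fin (m + 1)) :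
    ∑ i, (∫⁻ S, κ S {h | (S i, h) ∈ pointLoss ι}
      ∂(Measure.pi fun _ : Fin n => uniformExcept (fun j => (ι j, false)) k)).toReal ≤ c := by
  set D := uniformExcept (fun j => (ι j, false)) k with hD
  have : IsProbabilityMeasure D := isProbabilityMeasure_uniformExcept hm k
  have hmeas (i : Fin n) :
      Measurable fun S : Fin n → Example X => κ S {h | (S i, h) ∈ pointLoss ι} :=
    Kernel.measurable_kernel_prodMk_left (κ := κ) (t := {q | (q.1 i, q.2) ∈ pointLoss ι})
      ((measurableSet_pointLoss ι).preimage (by fun_prop))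
  have hfin (i : Fin n) : ∫⁻ S, κ S {h | (S i, h) ∈ pointLoss ι} ∂(Measure.pi fun _ => D) ≠ ∞ :=
    ne_top_of_le_ne_top ENNReal.one_ne_top
      ((lintegral_mono (g := fun _ => 1) fun S => prob_le_one).trans (by simp))
  rw [← ENNReal.toReal_sum fun i _ => hfin i, ← lintegral_finsetSum _ fun i _ => hmeas i]
  refine ENNReal.toReal_le_of_le_ofReal hc ?_
  have hsupp : ∀ᵐ S ∂(Measure.pi fun _ : Fin n => D), ∀ i, ∃ j, j ≠ k ∧ S i = (ι j, false) :=
    ae_all_iff.2 fun i => (Measure.tendsto_eval_ae_ae (i := i) (μ := fun _ : Fin n => D)).eventually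
      (ae_uniformExcept (fun j => (ι j, false)) k)
  refine (lintegral_mono_ae (g := fun _ => ENNReal.ofReal c) ?_).trans (by simp)
  filter_upwards [hsupp] with S hS
  have hreal : RealizableSample (pointClass ι) S := by
    obtain ⟨h, hh, hk⟩ := exists_mem_pointClass ι k
    refine ⟨h, hh, fun i => ?_⟩
    obtain ⟨j, hjk, hj⟩ := hS i
    rw [hj]
    simpa [hι.eq_iff] using (hk (ι j)).not.2 (hι.ne hjk)
  have hset (i : Fin n) : {h : pointClass ι | (S i, h) ∈ pointLoss ι}
      = {h | h.1 (S i).1 ≠ (S i).2} := by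
    obtain ⟨j, -, hj⟩ := hS i
    rw [hj, setOf_mem_pointLoss]
    simp
  have hle := hrisk S hreal
  rw [integral_empRisk, Nat.cast_one, mul_one_div,
    div_le_div_iff_of_pos_right (by positivity)] at hle
  have hofReal (s : Set (pointClass ι)) : κ S s = ENNReal.ofReal ((κ S).real s) :=
    (ofReal_measureReal (μ := κ S)).symm
  simp_rw [hset, hofReal]
  rw [← ENNReal.ofReal_sum_of_nonneg fun _ _ => measureReal_nonneg]
  exact ENNReal.ofReal_le_ofReal hle

/-- Bounded CMI and small empirical risk force the learner to output the indicator of the omitted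
point `ι k` with high probability. -/
theorem integral_missProb_le (hn : n ≠ 0) (hι : ι.Injective) (hm : m ≠ 0)
    (κ : Kernel (Fin n → Example X) (pointClass ι)) [IsMarkovKernel κ] {B c : ℝ} (hc : 0 ≤ c)
    (hcmi : ∀ D : Measure (Example X), IsProbabilityMeasure D → (cmi D κ : EReal) ≤ (B : EReal))
    (hrisk : ∀ s : Fin n → Example X, RealizableSample (pointClass ι) s →
      ∫ h, empRisk s h.1 ∂κ s ≤ c * (((1 : ℕ) : ℝ) / n)) (k : Fin (m + 1)) :
    Real.log (3 / 2) * n * ((m : ℝ)⁻¹ * ∫ S, (1 - (κ S).real {h | h.1 (ι k) = true})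
      ∂(Measure.pi fun _ : Fin n => uniformExcept (fun j => (ι j, false)) k))
      ≤ B + Real.log 2 * c := by
  set D := uniformExcept (fun j => (ι j, false)) k with hD
  have : IsProbabilityMeasure D := isProbabilityMeasure_uniformExcept hm k
  have hgen := generalization_le_cmi D κ (measurableSet_pointLoss ι)
  have htrain := sum_lintegral_trainLoss_le hn hι hm κ hc hrisk k
  have hmeas : Measurable fun S => (κ S).real {h | h.1 (ι k) = true} :=
    (κ.measurable_coe (measurableSet_eval_eq _ _ _)).ennreal_toReal
  have htest : (∫⁻ S, ∫⁻ x, κ S {h | (x, h) ∈ pointLoss ι} ∂D ∂(Measure.pi fun _ => D)).toReal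
      = (m : ℝ)⁻¹ * ∫ S, (1 - (κ S).real {h | h.1 (ι k) = true}) ∂(Measure.pi fun _ => D) := by
    simp_rw [hD, lintegral_pointLoss_uniformExcept hm hι, ← hD]
    have hm' : Measurable fun S => (m : ℝ)⁻¹ * (1 - (κ S).real {h | h.1 (ι k) = true}) :=
      (measurable_const.sub hmeas).const_mul _
    rw [← integral_const_mul, integral_eq_lintegral_of_nonneg_ae _ hm'.aestronglyMeasurable]
    exact ae_of_all _ fun S => mul_nonneg (by positivity) (sub_nonneg.2 measureReal_le_one)
  rw [htest] at hgen
  have h := (EReal.coe_ennreal_le_coe_ennreal_iff.2 hgen).trans (hcmi D inferInstance)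
  rw [EReal.coe_ennreal_ofReal, EReal.coe_le_coe_iff] at h
  have h1 := (le_max_left _ _).trans h
  have h2 := mul_le_mul_of_nonneg_left htrain (Real.log_nonneg one_le_two)
  linarith
end

theorem not_learnersWithin (X : Type*) [MeasurableSpace X] [MeasurableSingletonClass X] [Infinite X]
    (f : ℕ → ℝ) {c : ℝ} (hc : 0 ≤ c) : ¬ LearnersWithin X f c := by
  intro hlearn
  have hlog : 0 < Real.log (3 / 2) := Real.log_pos (by norm_num)
  -- `C` is the sample size per point of the support; it makes the bound of
  -- `integral_missProb_le` on the error probability at most `1 / 8`.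
  obtain ⟨C, hC⟩ := exists_nat_gt (max 0 (8 * (f 1 + Real.log 2 * c) / Real.log (3 / 2)))
  have hC0 : (0 : ℝ) < C := (le_max_left _ _).trans_lt hC
  have hC8 : 8 * (f 1 + Real.log 2 * c) < Real.log (3 / 2) * C := by
    rw [mul_comm (Real.log (3 / 2)), ← div_lt_iff₀ hlog]
    exact (le_max_right _ _).trans_lt hC
  have hCpos : C ≠ 0 := by exact_mod_cast hC0.ne'
  set m := 2 * 4 ^ C with hm
  have hm2 : 2 ≤ m := by have := Nat.one_le_pow C 4 (by norm_num); omega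
  have hm0 : m ≠ 0 := by omega
  have : Nontrivial (Fin (m + 1)) := Fin.nontrivial_iff_two_le.2 (by omega)
  set ι : Fin (m + 1) → X := fun j => Infinite.natEmbedding X j with hιdef
  have hι : ι.Injective := (Infinite.natEmbedding X).injective.comp Fin.val_injective
  obtain ⟨A, hA⟩ := hlearn 1 (pointClass ι) (fun h hh => measurable_of_mem_pointClass hh)
    (hasVCDim_pointClass hι)
  have hn : C * m ≠ 0 := mul_ne_zero hCpos hm0
  obtain ⟨hcmi, hrisk⟩ := hA (C * m) (Nat.one_le_iff_ne_zero.2 hn) (Nat.one_le_iff_ne_zero.2 hn)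
  have hmiss (k : Fin (m + 1)) :
      ∫ S, (1 - (A.law (C * m) S).real {h | h.1 (ι k) = true})
        ∂(Measure.pi fun _ : Fin (C * m) => uniformExcept (fun j => (ι j, false)) k) ≤ 1 / 8 := by
    have h := integral_missProb_le hn hι hm0 (A.law (C * m)) hc hcmi hrisk k
    set p := ∫ S, (1 - (A.law (C * m) S).real {h | h.1 (ι k) = true})
        ∂(Measure.pi fun _ : Fin (C * m) => uniformExcept (fun j => (ι j, false)) k)
    have hmR : (m : ℝ) ≠ 0 := by exact_mod_cast hm0
    have hcancel : Real.log (3 / 2) * ((C * m : ℕ) : ℝ) * ((m : ℝ)⁻¹ * p)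
        = Real.log (3 / 2) * C * p := by push_cast; field_simp
    rw [hcancel] at h
    have hpos : 0 < Real.log (3 / 2) * C := mul_pos hlog hC0
    by_contra! hp
    have := mul_lt_mul_of_pos_left hp hpos
    linarith
  have hexp : (2 : ℝ) ≤ m * (1 - 1 / m) ^ (C * m) := by
    have h := one_quarter_pow_le C (4 ^ C) (by positivity)
    rw [← hm] at h
    have h4 : (m : ℝ) * (1 / 4) ^ C = 2 := by
      rw [hm]; push_cast; rw [mul_assoc, ← mul_pow]; norm_num
    rw [← h4]
    exact mul_le_mul_of_nonneg_left h (by positivity)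
  have hlow := identification_lower_bound hm2 (e := fun j => (ι j, false))
    (fun j j' h => hι (Prod.ext_iff.1 h).1) (C * m)
    (a := fun j S => (A.law (C * m) S).real {h | h.1 (ι j) = true})
    (fun j => ((A.law (C * m)).measurable_coe (measurableSet_eval_eq _ _ _)).ennreal_toReal)
    (fun _ _ => measureReal_nonneg) (fun S => sum_measureReal_pointClass hι _) hexp
  have hupp := hlow.trans (Finset.sum_le_sum fun k _ => hmiss k)
  simp only [Finset.sum_const, Finset.card_univ, Fintype.card_fin, nsmul_eq_mul] at hupp
  push_cast at hupp
  have : (0 : ℝ) ≤ m := by positivity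
  linarith

end CMILearning

theorem theorem2 (X : Type*) [MeasurableSpace X] [MeasurableSingletonClass X] [Infinite X] :
    (¬ ∃ (f : ℕ → ℝ) (c : ℝ), 0 ≤ c ∧ CMILearning.LearnersWithin X f c) ∧
    (¬ ∃ (f : ℕ → ℝ) (c : ℝ), 0 ≤ c ∧ CMILearning.IsLinearBound f ∧
        CMILearning.LearnersWithin X f c) ∧
    (¬ ∃ f : ℕ → ℝ, CMILearning.IsLinearBound f ∧ CMILearning.LearnersWithin X f 0) := by
  refine ⟨?_, ?_, ?_⟩
  · rintro ⟨f, c, hc, h⟩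
    exact CMILearning.not_learnersWithin X f hc h
  · rintro ⟨f, c, hc, -, h⟩
    exact CMILearning.not_learnersWithin X f hc h
  · rintro ⟨f, -, h⟩
    exact CMILearning.not_learnersWithin X f le_rfl h
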